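/- For integers $n\ge k\ge 0$ let $s(n,k)$ denote the (signed) Stirling numbers of the first kind, i.e. $x(x-1)\cdots(x-n+1)=\sum_{k=0}^{n}s(n,k)x^k$. For integers $k\ge1$ and $m\ge2$ put $$Q(k,m)=\sum_{\ell=0}^{m}\binom{k+\ell-1}{k-1}\,s(k+m-1,k+\ell-1)\Bigl(\frac{k+m-2}{2}\Bigr)^{\ell},$$ and for $\alpha\in\mathbb{R}$ and $j\ge 1$ let $\langle\alpha\rangle_j=\alpha(\alpha-1)\cdots(\alpha-j+1)$. For $\alpha\in\mathbb{R}$ and $n\ge1$ put $$c_n(\alpha)=\sum_{j=1}^{n}(-1)^{j}\frac{\langle\alpha\rangle_j}{j!}\sum_{\ell=1}^{j}(-1)^{\ell}(2\ell)!\binom{j}{\ell}\frac{Q(2\ell,2n)}{(2\ell+2n)!}.$$ **Theorem.** Let $\alpha\in\mathbb{R}$. For every real $x$ with $|x|<1$ the series below converges absolutely and $$\biggl[\frac{(\arccos x)^2}{2(1-x)}\biggr]^{\alpha}=1+\sum_{n=1}^{\infty}c_n(\alpha)\,[2(x-1)]^{n}.$$ This is the Taylor expansion of the left-hand side at $x=1^-$: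 for every $n\ge1$, $$\lim_{x\to1^-}\frac{\mathrm{d}^n}{\mathrm{d}x^n}\biggl[\frac{(\arccos x)^2}{2(1-x)}\biggr]^{\alpha}=n!\,2^n c_n(\alpha).$$ -/

import Mathlib

open Filter Topology

noncomputable section

/-- The (signed) Stirling number of the first kind `s(n, k)`, the coefficient of `x ^ k` in
`x (x - 1) ⋯ (x - n + 1)`. Mathlib's `Nat.stirlingFirst n k` is its absolute value; it is `0` for
`k > n`, so the sign `(-1) ^ (n + k)` is the usual `(-1) ^ (n - k)`. -/
def stirlingS (n k : ℕ) : ℝ :=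
  (-1) ^ (n + k) * (Nat.stirlingFirst n k : ℝ)

/-- `Q(k, m) = ∑_{ℓ = 0}^{m} C(k + ℓ - 1, k - 1) s(k + m - 1, k + ℓ - 1) ((k + m - 2) / 2) ^ ℓ`,
for `k ≥ 1` and `m ≥ 2` (it is used only for such arguments, where the subtractions of natural
numbers are genuine). -/
def arcQ (k m : ℕ) : ℝ :=
  ∑ l ∈ Finset.range (m + 1),
    (Nat.choose (k + l - 1) (k - 1) : ℝ) * stirlingS (k + m - 1) (k + l - 1) *
      (((k : ℝ) + (m : ℝ) - 2) / 2) ^ l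

/-- The falling factorial `⟨β⟩_n = β (β - 1) ⋯ (β - n + 1)`. -/
def fallingFactorial (β : ℝ) (n : ℕ) : ℝ :=
  ∏ i ∈ Finset.range n, (β - (i : ℝ))

/-- The coefficient of `[2 (x - 1)] ^ n`, for `n ≥ 1`. -/
def arccosCoeff (α : ℝ) (n : ℕ) : ℝ :=
  ∑ j ∈ Finset.Icc 1 n,
    (-1) ^ j * (fallingFactorial α j / (Nat.factorial j : ℝ)) *
      ∑ l ∈ Finset.Icc 1 j,
        (-1) ^ l * (Nat.factorial (2 * l) : ℝ) * (Nat.choose j l : ℝ) *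
          (arcQ (2 * l) (2 * n) / (Nat.factorial (2 * l + 2 * n) : ℝ))

end

open Polynomial in
theorem coeff_descPochhammer (n k : ℕ) : (descPochhammer ℝ n).coeff k = stirlingS n k := by
  induction n generalizing k with
  | zero => cases k <;> simp [stirlingS, coeff_one]
  | succ n ih =>
    have hC : (n : ℝ[X]) = C (n : ℝ) := by simp
    rw [descPochhammer_succ_right, mul_sub, coeff_sub, hC, coeff_mul_C]
    cases k with
    | zero =>
      rw [coeff_mul_X_zero, ih]
      cases n <;> simp [stirlingS]
    | succ k =>
      rw [coeff_mul_X, ih, ih]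
      simp only [stirlingS, Nat.stirlingFirst_succ_succ]
      push_cast
      ring

/-- The central factorial polynomial `∏_{i < N} (X - i²)`. -/
noncomputable def centralFactorial (N : ℕ) : Polynomial ℝ :=
  ∏ i ∈ Finset.range N, (Polynomial.X - Polynomial.C ((i : ℝ) ^ 2))

open Polynomial in
theorem coeff_centralFactorial_succ_succ (N l : ℕ) :
    (centralFactorial (N + 1)).coeff (l + 1) =
      (centralFactorial N).coeff l - (N : ℝ) ^ 2 * (centralFactorial N).coeff (l + 1) := by
  rw [centralFactorial, Finset.prod_range_succ, ← centralFactorial, mul_sub, coeff_sub,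
    coeff_mul_X, coeff_mul_C, mul_comm]

open Polynomial in
theorem X_mul_descPochhammer_comp (M : ℕ) :
    X * (descPochhammer ℝ (2 * M + 1)).comp (X + C (M : ℝ)) =
      expand ℝ 2 (centralFactorial (M + 1)) := by
  induction M with
  | zero => simp [centralFactorial, sq]
  | succ M ih =>
    rw [centralFactorial, Finset.prod_range_succ, ← centralFactorial, map_mul, ← ih,
      show 2 * (M + 1) + 1 = (2 * M + 1 + 1) + 1 by ring, descPochhammer_succ_left,
      descPochhammer_succ_right]
    have h : (X - 1 : ℝ[X]).comp (X + C ((M + 1 : ℕ) : ℝ)) = X + C (M : ℝ) := by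
      simp; ring
    simp only [mul_comp, comp_assoc, h, X_comp, sub_comp, natCast_comp, map_sub, expand_X, expand_C]
    push_cast
    simp only [map_add, map_one, map_pow, map_natCast]
    ring

open Polynomial in
theorem arcQ_eq_coeff (l n : ℕ) (hl : 1 ≤ l) (hn : 1 ≤ n) :
    arcQ (2 * l) (2 * n) = (centralFactorial (l + n)).coeff l := by
  obtain ⟨M, hM⟩ : ∃ M, l + n = M + 1 := ⟨l + n - 1, by omega⟩
  have h1 : (centralFactorial (l + n)).coeff l =
      ((descPochhammer ℝ (2 * M + 1)).comp (X + C (M : ℝ))).coeff (2 * l - 1) := by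
    rw [← coeff_X_mul (p := (descPochhammer ℝ (2 * M + 1)).comp (X + C (M : ℝ))),
      X_mul_descPochhammer_comp, ← hM,
      show 2 * l - 1 + 1 = l * 2 by omega, coeff_expand_mul (by norm_num)]
  rw [h1, ← taylor_apply, taylor_coeff, eval_eq_sum_range' (n := 2 * n + 1)]
  · rw [arcQ]
    refine Finset.sum_congr rfl fun i _ => ?_
    rw [hasseDeriv_coeff, coeff_descPochhammer]
    have e1 : 2 * l + 2 * n - 1 = 2 * M + 1 := by omega
    have e2 : 2 * l + i - 1 = i + (2 * l - 1) := by omega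
    have e3 : ((2 * l : ℕ) + (2 * n : ℕ) - 2 : ℝ) / 2 = M := by
      have : (l : ℝ) + n = M + 1 := by exact_mod_cast hM
      push_cast; linarith
    rw [e1, e2, e3]
  · refine lt_of_le_of_lt (natDegree_hasseDeriv_le _ _) ?_
    have : (descPochhammer ℝ (2 * M + 1)).natDegree = 2 * M + 1 := descPochhammer_natDegree _ _
    omega

open PowerSeries in
theorem arcsinSq_derivative_sq (h : ℂ⟦X⟧) (hh : (1 - X) * (h + 2 * X * d⁄dX ℂ h) ^ 2 = 1) :
    X * (1 - X) * (d⁄dX ℂ (X * h ^ 2)) ^ 2 = X * h ^ 2 := by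
  have : d⁄dX ℂ (X * h ^ 2) = h * (h + 2 * X * d⁄dX ℂ h) := by
    simp only [Derivation.leibniz, derivative_pow, derivative_X, smul_eq_mul]
    push_cast
    ring
  rw [this]
  linear_combination (X * h ^ 2) * hh

open PowerSeries in
theorem derivative_derivative_of_sq (A : ℂ⟦X⟧) (hA : X * (1 - X) * (d⁄dX ℂ A) ^ 2 = A)
    (h0 : d⁄dX ℂ A ≠ 0) :
    2 * X * (1 - X) * d⁄dX ℂ (d⁄dX ℂ A) + (1 - 2 * X) * d⁄dX ℂ A = 1 := by
  have h := congrArg (d⁄dX ℂ) hA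
  simp only [Derivation.leibniz, derivative_pow, derivative_X, smul_eq_mul, map_sub,
    derivative_one] at h
  refine mul_left_cancel₀ h0 ?_
  push_cast at h
  linear_combination h

open PowerSeries in
theorem derivative_derivative_pow (A : ℂ⟦X⟧) (hA : X * (1 - X) * (d⁄dX ℂ A) ^ 2 = A)
    (hA' : 2 * X * (1 - X) * d⁄dX ℂ (d⁄dX ℂ A) + (1 - 2 * X) * d⁄dX ℂ A = 1) (l : ℕ) :
    4 * X * (1 - X) * d⁄dX ℂ (d⁄dX ℂ (A ^ (l + 1))) + 2 * (1 - 2 * X) * d⁄dX ℂ (A ^ (l + 1)) =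
      C ((2 * l + 2) * (2 * l + 1) : ℂ) * A ^ l := by
  have hc : (C ((2 * l + 2) * (2 * l + 1) : ℂ) : ℂ⟦X⟧) = (2 * (l : ℂ⟦X⟧) + 2) * (2 * l + 1) := by
    simp only [map_mul, map_add, map_natCast, map_ofNat, map_one]
  rw [hc]
  cases l with
  | zero =>
    simp only [zero_add, pow_one, pow_zero]
    push_cast
    linear_combination 2 * hA'
  | succ l =>
    simp only [Derivation.leibniz, derivative_pow, smul_eq_mul, Derivation.map_natCast,
      Nat.add_sub_cancel]
    push_cast
    linear_combination (4 * ((l : ℂ⟦X⟧) + 2) * (l + 1) * A ^ l) * hA +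
      (2 * ((l : ℂ⟦X⟧) + 2) * A ^ (l + 1)) * hA'

open PowerSeries in
theorem coeff_euler_operator (f : ℂ⟦X⟧) (N : ℕ) :
    coeff N (4 * X * (1 - X) * d⁄dX ℂ (d⁄dX ℂ f) + 2 * (1 - 2 * X) * d⁄dX ℂ f) =
      (2 * N + 2) * (2 * N + 1) * coeff (N + 1) f - 4 * N ^ 2 * coeff N f := by
  have e : 4 * X * (1 - X) * d⁄dX ℂ (d⁄dX ℂ f) + 2 * (1 - 2 * X) * d⁄dX ℂ f =
      C (4 : ℂ) * (X * d⁄dX ℂ (d⁄dX ℂ f)) - C (4 : ℂ) * (X * (X * d⁄dX ℂ (d⁄dX ℂ f))) +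
      C (2 : ℂ) * d⁄dX ℂ f - C (4 : ℂ) * (X * d⁄dX ℂ f) := by
    simp only [map_ofNat]
    ring
  rw [e]
  simp only [map_sub, map_add, coeff_C_mul]
  match N with
  | 0 => simp [coeff_derivative]
  | 1 =>
    rw [coeff_succ_X_mul, coeff_succ_X_mul, coeff_succ_X_mul]
    simp [coeff_derivative]
    ring
  | N + 2 =>
    rw [coeff_succ_X_mul, coeff_succ_X_mul, coeff_succ_X_mul, coeff_succ_X_mul]
    simp only [coeff_derivative]; push_cast; ring

open PowerSeries in
theorem coeff_pow_eq_centralFactorial (A : ℂ⟦X⟧) (h0 : constantCoeff A = 0)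
    (hA : X * (1 - X) * (d⁄dX ℂ A) ^ 2 = A)
    (hA' : 2 * X * (1 - X) * d⁄dX ℂ (d⁄dX ℂ A) + (1 - 2 * X) * d⁄dX ℂ A = 1) (N l : ℕ) :
    (-4) ^ l * coeff N (A ^ l) =
      (-4) ^ N * (Nat.factorial (2 * l) : ℂ) / (Nat.factorial (2 * N) : ℂ) *
        ((centralFactorial N).coeff l : ℂ) := by
  induction N generalizing l with
  | zero =>
    cases l with
    | zero => simp [centralFactorial]
    | succ l => simp [centralFactorial, Polynomial.coeff_one, h0]
  | succ N ih =>
    have hz : (2 * (N : ℂ) + 2) * (2 * N + 1) ≠ 0 := by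
      exact_mod_cast (by positivity : (2 * N + 2) * (2 * N + 1) ≠ 0)
    have hF : (Nat.factorial (2 * (N + 1)) : ℂ) =
        (2 * N + 2) * (2 * N + 1) * (Nat.factorial (2 * N) : ℂ) := by
      rw [show 2 * (N + 1) = 2 * N + 1 + 1 by ring, Nat.factorial_succ, Nat.factorial_succ]
      push_cast; ring
    have hN : (Nat.factorial (2 * N) : ℂ) ≠ 0 := by exact_mod_cast Nat.factorial_ne_zero _
    cases l with
    | zero =>
      have : (centralFactorial (N + 1)).coeff 0 = 0 := by
        rw [centralFactorial, Finset.prod_range_succ']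
        simp
      simp [this, coeff_one]
    | succ l =>
      have h := congrArg (coeff N) (derivative_derivative_pow A hA hA' l)
      rw [coeff_euler_operator, coeff_C_mul] at h
      have hl : (Nat.factorial (2 * (l + 1)) : ℂ) =
          (2 * l + 2) * (2 * l + 1) * (Nat.factorial (2 * l) : ℂ) := by
        rw [show 2 * (l + 1) = 2 * l + 1 + 1 by ring, Nat.factorial_succ, Nat.factorial_succ]
        push_cast; ring
      have i1 := ih l
      have i2 := ih (l + 1)
      rw [coeff_centralFactorial_succ_succ, hF]
      rw [hl] at i2 ⊢
      rw [div_mul_eq_mul_div, eq_div_iff hN] at i1 i2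
      rw [div_mul_eq_mul_div, eq_div_iff (mul_ne_zero hz hN)]
      push_cast
      have h4 : coeff (N + 1) (A ^ (l + 1)) * ((2 * N + 2) * (2 * N + 1)) =
        4 * N ^ 2 * coeff N (A ^ (l + 1)) + (2 * l + 2) * (2 * l + 1) * coeff N (A ^ l) := by
        linear_combination h
      linear_combination ((-4) ^ (l + 1) * (Nat.factorial (2 * N) : ℂ)) * h4 + 4 * N ^ 2 * i2
        - 4 * (2 * l + 2) * (2 * l + 1) * i1

open PowerSeries in
theorem coeff_sq_pow (h : ℂ⟦X⟧) (h0 : constantCoeff h = 1)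
    (hh : (1 - X) * (h + 2 * X * d⁄dX ℂ h) ^ 2 = 1) (l n : ℕ) (hl : 1 ≤ l) (hn : 1 ≤ n) :
    coeff n ((h ^ 2) ^ l) = (-4) ^ n * ((Nat.factorial (2 * l) : ℂ) *
      ((arcQ (2 * l) (2 * n) / (Nat.factorial (2 * l + 2 * n) : ℝ) : ℝ) : ℂ)) := by
  have hA := arcsinSq_derivative_sq h hh
  have hne : d⁄dX ℂ (X * h ^ 2) ≠ 0 := by
    intro h'
    rw [h'] at hA
    have : coeff 1 (X * h ^ 2) = 1 := by
      rw [coeff_succ_X_mul]; simp [h0]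
    rw [← hA] at this
    simp at this
  have key := coeff_pow_eq_centralFactorial (X * h ^ 2) (by simp) hA
    (derivative_derivative_of_sq _ hA hne) (l + n) l
  rw [mul_pow, add_comm l n, coeff_X_pow_mul, add_comm n l, ← arcQ_eq_coeff l n hl hn, pow_add,
    mul_add] at key
  have h4 : (-4 : ℂ) ^ l ≠ 0 := pow_ne_zero _ (by norm_num)
  apply mul_left_cancel₀ h4
  rw [key]
  push_cast
  ring

open PowerSeries in
theorem X_pow_dvd_of_derivative (f v d : ℂ⟦X⟧) (M : ℕ) (hf : constantCoeff f = 1)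
    (hd : constantCoeff d = 0) (H : X ^ M ∣ d⁄dX ℂ d * f - v * d) : X ^ (M + 1) ∣ d := by
  suffices ∀ k ≤ M, X ^ (k + 1) ∣ d from this M le_rfl
  intro k hk
  induction k with
  | zero => rw [zero_add, pow_one]; exact X_dvd_iff.2 hd
  | succ k ih =>
    obtain ⟨e, he⟩ := ih (by omega)
    have h1 : X ^ (k + 1) ∣ d⁄dX ℂ d * f := by
      have := dvd_add ((pow_dvd_pow X hk).trans H) (Dvd.dvd.mul_left ⟨e, he⟩ v)
      simpa using this
    have hu : IsUnit f := isUnit_iff_constantCoeff.2 (by simp [hf])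
    have h2 : X ^ (k + 1) ∣ d⁄dX ℂ d := (hu.dvd_mul_right).1 h1
    rw [X_pow_dvd_iff] at h2 ⊢
    intro m hm
    cases m with
    | zero => simpa using hd
    | succ m =>
      have := h2 m (by omega)
      rw [coeff_derivative] at this
      refine (mul_eq_zero.1 this).resolve_right ?_
      exact_mod_cast Nat.succ_ne_zero m

open PowerSeries in
theorem binomial_partial_sum_derivative (α : ℂ) (b : ℕ → ℂ)
    (hb : ∀ j : ℕ, (j + 1 : ℂ) * b (j + 1) = (α - j) * b j) (v : ℂ⟦X⟧) (M : ℕ) :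
    d⁄dX ℂ (∑ j ∈ Finset.range (M + 1), C (b j) * v ^ j) * (1 + v) -
      C α * d⁄dX ℂ v * ∑ j ∈ Finset.range (M + 1), C (b j) * v ^ j =
      - (C ((α - M) * b M) * d⁄dX ℂ v * v ^ M) := by
  induction M with
  | zero => simp; ring
  | succ M ih =>
    rw [Finset.sum_range_succ, map_add, add_mul, mul_add, Derivation.leibniz, derivative_pow]
    have := congrArg (C : ℂ → ℂ⟦X⟧) (hb M)
    simp only [derivative_C, smul_eq_mul, Nat.add_sub_cancel, map_mul, map_sub, map_add, map_natCast, map_one] at this ih ⊢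
    push_cast
    linear_combination ih + (d⁄dX ℂ v * v ^ M ) * this

open PowerSeries in
theorem coeff_of_power_ode (α : ℂ) (b : ℕ → ℂ) (hb0 : b 0 = 1)
    (hb : ∀ j : ℕ, (j + 1 : ℂ) * b (j + 1) = (α - j) * b j) (f g : ℂ⟦X⟧)
    (hf : constantCoeff f = 1) (hg : constantCoeff g = 1)
    (H : d⁄dX ℂ g * f = C α * d⁄dX ℂ f * g) (n : ℕ) :
    coeff n g = ∑ j ∈ Finset.range (n + 1), b j * coeff n ((f - 1) ^ j) := by
  have hv : X ∣ f - 1 := X_dvd_iff.2 (by simp [hf])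
  have hP := binomial_partial_sum_derivative α b hb (f - 1) n
  set P := ∑ j ∈ Finset.range (n + 1), C (b j) * (f - 1) ^ j with hPdef
  have hP0 : constantCoeff P = 1 := by
    rw [hPdef, Finset.sum_range_succ']
    simp [hf, hb0]
  have key : X ^ (n + 1) ∣ g - P := by
    apply X_pow_dvd_of_derivative f (C α * d⁄dX ℂ f) (g - P) n hf (by simp [hg, hP0])
    refine (pow_dvd_pow_of_dvd hv n).trans ⟨C ((α - n) * b n) * d⁄dX ℂ f, ?_⟩
    simp only [map_sub, derivative_one, sub_zero, map_mul, map_natCast] at hP ⊢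
    linear_combination H - hP
  have := (X_pow_dvd_iff.1 key) n (Nat.lt_succ_self n)
  rw [map_sub, sub_eq_zero] at this
  rw [this, hPdef, map_sum]
  simp

open PowerSeries in
theorem coeff_eq_arccosCoeff (α : ℝ) (h g : ℂ⟦X⟧) (h0 : constantCoeff h = 1)
    (hh : (1 - X) * (h + 2 * X * d⁄dX ℂ h) ^ 2 = 1) (hg : constantCoeff g = 1)
    (H : d⁄dX ℂ g * h ^ 2 = C (α : ℂ) * d⁄dX ℂ (h ^ 2) * g) (n : ℕ) (hn : 1 ≤ n) :
    coeff n g = (-4) ^ n * (arccosCoeff α n : ℂ) := by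
  let b : ℕ → ℂ := fun j => ((fallingFactorial α j / (Nat.factorial j : ℝ) : ℝ) : ℂ)
  have hb : ∀ j : ℕ, (j + 1 : ℂ) * b (j + 1) = ((α : ℂ) - j) * b j := by
    intro j
    have h1 : (Nat.factorial j : ℝ) ≠ 0 := by positivity
    have h2 : (j + 1 : ℝ) ≠ 0 := by positivity
    have : (j + 1 : ℝ) * (fallingFactorial α (j + 1) / (Nat.factorial (j + 1) : ℝ)) =
        (α - j) * (fallingFactorial α j / (Nat.factorial j : ℝ)) := by
      rw [fallingFactorial, Finset.prod_range_succ, ← fallingFactorial, Nat.factorial_succ]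
      push_cast
      field_simp
    have h3 := congrArg (fun x : ℝ => (x : ℂ)) this
    simp only [Complex.ofReal_mul, Complex.ofReal_add, Complex.ofReal_sub,
      Complex.ofReal_natCast, Complex.ofReal_one] at h3
    exact h3
  have hb0 : b 0 = 1 := by simp [b, fallingFactorial]
  rw [coeff_of_power_ode (α : ℂ) b hb0 hb (h ^ 2) g (by simp [h0]) hg H n,
    Finset.range_eq_Ico, Finset.sum_eq_sum_Ico_succ_bot (Nat.succ_pos n)]
  have e0 : coeff n ((h ^ 2 - 1) ^ 0) = (0 : ℂ) := by
    rw [pow_zero, coeff_one, if_neg (by omega)]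
  rw [e0, mul_zero, zero_add, arccosCoeff, Complex.ofReal_sum, Finset.mul_sum]
  have hI : Finset.Ico (0 + 1) (n + 1) = Finset.Icc 1 n := by ext; simp only [Finset.mem_Ico, Finset.mem_Icc]; omega
  rw [hI]
  refine Finset.sum_congr rfl fun j _ => ?_
  have h1 : ∀ m ∈ Finset.Icc 1 j, coeff n ((h ^ 2) ^ m * (-1) ^ (j - m) * (j.choose m : ℂ⟦X⟧)) =
      (-1) ^ j * ((-1) ^ m * (j.choose m : ℂ)) * coeff n ((h ^ 2) ^ m) := by
    intro m hm
    have hmj := (Finset.mem_Icc.1 hm).2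
    have e1 : (-1 : ℂ) ^ (j - m) = (-1) ^ j * (-1) ^ m := by
      have : (-1 : ℂ) ^ m * (-1) ^ m = 1 := by rw [← mul_pow]; simp
      conv_rhs => rw [← Nat.sub_add_cancel hmj, pow_add, mul_assoc, this, mul_one]
    have e2 : (h ^ 2) ^ m * (-1) ^ (j - m) * (j.choose m : ℂ⟦X⟧) =
        C ((-1) ^ (j - m) * (j.choose m : ℂ)) * (h ^ 2) ^ m := by
      simp only [map_mul, map_pow, map_neg, map_one, map_natCast]
      ring
    rw [e2, coeff_C_mul, e1]
    ring
  have h2 : coeff n ((h ^ 2) ^ 0 * (-1) ^ (j - 0) * (j.choose 0 : ℂ⟦X⟧)) = 0 := by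
    have : (h ^ 2) ^ 0 * (-1) ^ (j - 0) * (j.choose 0 : ℂ⟦X⟧) = C ((-1) ^ j) := by simp
    rw [this, coeff_C, if_neg (by omega)]
  have hJ : Finset.Ico (0 + 1) (j + 1) = Finset.Icc 1 j := by ext; simp only [Finset.mem_Ico, Finset.mem_Icc]; omega
  rw [sub_eq_add_neg, add_pow, map_sum, Finset.range_eq_Ico,
    Finset.sum_eq_sum_Ico_succ_bot (Nat.succ_pos j), h2, zero_add, hJ, Finset.sum_congr rfl h1,
    Complex.ofReal_mul, Complex.ofReal_sum, Finset.mul_sum, Finset.mul_sum, Finset.mul_sum]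
  refine Finset.sum_congr rfl fun m hm => ?_
  rw [coeff_sq_pow h h0 hh m n (Finset.mem_Icc.1 hm).1 hn]
  simp only [b]
  push_cast
  ring

/-- The formal power series of Taylor coefficients of `f` at `0`. -/
noncomputable def taylorPowerSeries (f : ℂ → ℂ) : PowerSeries ℂ :=
  PowerSeries.mk fun n => (Nat.factorial n : ℂ)⁻¹ * iteratedDeriv n f 0

namespace taylorPowerSeries

theorem coeff (f : ℂ → ℂ) (n : ℕ) : PowerSeries.coeff n (taylorPowerSeries f) =
    (Nat.factorial n : ℂ)⁻¹ * iteratedDeriv n f 0 := by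
  simp [taylorPowerSeries]

theorem constantCoeff (f : ℂ → ℂ) : PowerSeries.constantCoeff (taylorPowerSeries f) = f 0 := by
  rw [← PowerSeries.coeff_zero_eq_constantCoeff_apply, coeff]
  simp

theorem congr {f g : ℂ → ℂ} (h : f =ᶠ[𝓝 0] g) : taylorPowerSeries f = taylorPowerSeries g := by
  ext n
  rw [coeff, coeff, h.iteratedDeriv_eq]

theorem const (c : ℂ) : taylorPowerSeries (fun _ => c) = PowerSeries.C c := by
  ext n
  rw [coeff, iteratedDeriv_const, PowerSeries.coeff_C]
  split_ifs with h <;> simp [h]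

theorem derivative (f : ℂ → ℂ) :
    taylorPowerSeries (deriv f) = PowerSeries.derivative ℂ (taylorPowerSeries f) := by
  ext n
  rw [PowerSeries.coeff_derivative, coeff, coeff, ← iteratedDeriv_succ', Nat.factorial_succ]
  have : (n + 1 : ℂ) ≠ 0 := by exact_mod_cast Nat.succ_ne_zero n
  push_cast
  field_simp

theorem id : taylorPowerSeries (fun z => z) = PowerSeries.X := by
  have hd : deriv (fun z : ℂ => z) = fun _ => 1 := by ext; simp
  refine PowerSeries.derivative.ext ?_ (by simp [constantCoeff])
  rw [← derivative, hd, const, PowerSeries.derivative_X, map_one]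

theorem add {f g : ℂ → ℂ} (hf : AnalyticAt ℂ f 0) (hg : AnalyticAt ℂ g 0) :
    taylorPowerSeries (fun z => f z + g z) = taylorPowerSeries f + taylorPowerSeries g := by
  ext n
  rw [map_add, coeff, coeff, coeff, iteratedDeriv_fun_add hf.contDiffAt hg.contDiffAt, mul_add]

theorem mul {f g : ℂ → ℂ} (hf : AnalyticAt ℂ f 0) (hg : AnalyticAt ℂ g 0) :
    taylorPowerSeries (fun z => f z * g z) = taylorPowerSeries f * taylorPowerSeries g := by
  ext n
  rw [PowerSeries.coeff_mul, coeff, iteratedDeriv_fun_mul hf.contDiffAt hg.contDiffAt,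
    Finset.mul_sum, Finset.Nat.sum_antidiagonal_eq_sum_range_succ
      (fun i j => PowerSeries.coeff i (taylorPowerSeries f) *
        PowerSeries.coeff j (taylorPowerSeries g))]
  refine Finset.sum_congr rfl fun i hi => ?_
  rw [coeff, coeff, Nat.cast_choose ℂ (Nat.lt_succ_iff.1 (Finset.mem_range.1 hi))]
  have h1 := Nat.cast_ne_zero (R := ℂ).2 (Nat.factorial_ne_zero n)
  field_simp

theorem pow_two {f : ℂ → ℂ} (hf : AnalyticAt ℂ f 0) :
    taylorPowerSeries (fun z => f z ^ 2) = taylorPowerSeries f ^ 2 := by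
  simp only [sq, mul hf hf]

end taylorPowerSeries

section

open Complex MeasureTheory

theorem one_sub_mul_sq_mem_slitPlane {z : ℂ} (hz : ‖z‖ < 1) {s : ℝ} (hs : s ∈ Set.Icc (0 : ℝ) 1) :
    1 - z * (s : ℂ) ^ 2 ∈ slitPlane := by
  have h : (1 : ℂ) + -(z * (s : ℂ) ^ 2) ∈ slitPlane := by
    apply mem_slitPlane_of_norm_lt_one
    rw [norm_neg, norm_mul, norm_pow, norm_real, Real.norm_eq_abs, abs_of_nonneg hs.1]
    have : s ^ 2 ≤ 1 := pow_le_one₀ hs.1 hs.2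
    nlinarith [norm_nonneg z]
  simpa [sub_eq_add_neg] using h

/-- The function `arcsin (√z) / √z`, as an integral. -/
noncomputable def arcsinQuot (z : ℂ) : ℂ :=
  ∫ s in (0 : ℝ)..1, (1 - z * (s : ℂ) ^ 2) ^ (-(1 / 2) : ℂ)

theorem continuousOn_one_sub_mul_sq_cpow (a : ℂ) {r : ℝ} (hr : r < 1) :
    ContinuousOn (fun p : ℂ × ℝ => (1 - p.1 * (p.2 : ℂ) ^ 2) ^ a)
      (Metric.closedBall 0 r ×ˢ Set.Icc (0 : ℝ) 1) := by
  refine ContinuousOn.cpow_const (by fun_prop) ?_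
  rintro ⟨z, s⟩ ⟨h1, h2⟩
  exact one_sub_mul_sq_mem_slitPlane ((mem_closedBall_zero_iff.1 h1).trans_lt hr) h2

theorem continuousOn_one_sub_mul_sq_cpow_right (a : ℂ) {z : ℂ} (hz : ‖z‖ < 1) :
    ContinuousOn (fun s : ℝ => (1 - z * (s : ℂ) ^ 2) ^ a) (Set.Icc (0 : ℝ) 1) :=
  ContinuousOn.cpow_const (by fun_prop) fun _ hs => one_sub_mul_sq_mem_slitPlane hz hs

theorem intervalIntegrable_one_sub_mul_sq_cpow (a : ℂ) {z : ℂ} (hz : ‖z‖ < 1) :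
    IntervalIntegrable (fun s : ℝ => (1 - z * (s : ℂ) ^ 2) ^ a) volume 0 1 := by
  apply ContinuousOn.intervalIntegrable
  rw [Set.uIcc_of_le zero_le_one]
  exact continuousOn_one_sub_mul_sq_cpow_right a hz

theorem hasDerivAt_arcsinQuot {z : ℂ} (hz : ‖z‖ < 1) :
    IntervalIntegrable (fun s : ℝ =>
      (s : ℂ) ^ 2 / 2 * (1 - z * (s : ℂ) ^ 2) ^ (-(3 / 2) : ℂ)) volume 0 1 ∧
    HasDerivAt arcsinQuot
      (∫ s in (0 : ℝ)..1, (s : ℂ) ^ 2 / 2 * (1 - z * (s : ℂ) ^ 2) ^ (-(3 / 2) : ℂ)) z := by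
  obtain ⟨r, hzr, hr⟩ := exists_between hz
  have hcont : ContinuousOn (fun p : ℂ × ℝ => (p.2 : ℂ) ^ 2 / 2 *
      (1 - p.1 * (p.2 : ℂ) ^ 2) ^ (-(3 / 2) : ℂ)) (Metric.closedBall 0 r ×ˢ Set.Icc (0 : ℝ) 1) :=
    ContinuousOn.mul (by fun_prop) (continuousOn_one_sub_mul_sq_cpow _ hr)
  obtain ⟨B, hB⟩ := ((isCompact_closedBall (0 : ℂ) r).prod
    (isCompact_Icc (a := (0 : ℝ)) (b := 1))).exists_bound_of_continuousOn hcont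
  have hball : Metric.ball (0 : ℂ) r ∈ 𝓝 z :=
    Metric.isOpen_ball.mem_nhds (mem_ball_zero_iff.2 hzr)
  have hI : Set.uIoc (0 : ℝ) 1 ⊆ Set.Icc 0 1 := by
    rw [Set.uIoc_of_le zero_le_one]; exact Set.Ioc_subset_Icc_self
  have hmeas : ∀ {f : ℝ → ℂ}, IntervalIntegrable f volume 0 1 →
      AEStronglyMeasurable f (volume.restrict (Set.uIoc 0 1)) := fun h =>
    h.def'.aestronglyMeasurable
  have hint : IntervalIntegrable (fun s : ℝ =>
      (s : ℂ) ^ 2 / 2 * (1 - z * (s : ℂ) ^ 2) ^ (-(3 / 2) : ℂ)) volume 0 1 :=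
    (intervalIntegrable_one_sub_mul_sq_cpow _ hz).continuousOn_mul (by fun_prop)
  refine intervalIntegral.hasDerivAt_integral_of_dominated_loc_of_deriv_le
    (F' := fun (z : ℂ) (s : ℝ) => (s : ℂ) ^ 2 / 2 * (1 - z * (s : ℂ) ^ 2) ^ (-(3 / 2) : ℂ))
    (bound := fun _ => B) hball ?_ (intervalIntegrable_one_sub_mul_sq_cpow _ hz) (hmeas hint) ?_ (by simp) ?_
  · filter_upwards [hball] with w hw
    exact hmeas (intervalIntegrable_one_sub_mul_sq_cpow _ ((mem_ball_zero_iff.1 hw).trans hr))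
  · refine Eventually.of_forall fun s hs w hw => hB (w, s) ⟨Metric.ball_subset_closedBall hw, hI hs⟩
  · refine Eventually.of_forall fun s hs w hw => ?_
    have hsl := one_sub_mul_sq_mem_slitPlane ((mem_ball_zero_iff.1 hw).trans hr) (hI hs)
    have h1 : HasDerivAt (fun w : ℂ => 1 - w * (s : ℂ) ^ 2) (-(1 * (s : ℂ) ^ 2)) w :=
      ((hasDerivAt_id w).mul_const _).const_sub 1
    refine (h1.cpow_const (c := (-(1 / 2) : ℂ)) hsl).congr_deriv ?_
    rw [show (-(1 / 2) - 1 : ℂ) = -(3 / 2) by norm_num]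
    ring

theorem arcsinQuot_add_deriv {z : ℂ} (hz : ‖z‖ < 1) :
    arcsinQuot z + 2 * z * deriv arcsinQuot z = (1 - z) ^ (-(1 / 2) : ℂ) := by
  obtain ⟨hint, hd⟩ := hasDerivAt_arcsinQuot hz
  have hint0 := intervalIntegrable_one_sub_mul_sq_cpow (-(1 / 2)) hz
  rw [hd.deriv, arcsinQuot, ← intervalIntegral.integral_const_mul,
    ← intervalIntegral.integral_add hint0 (hint.const_mul _)]
  rw [intervalIntegral.integral_eq_sub_of_hasDerivAt
    (f := fun s : ℝ => (s : ℂ) * (1 - z * (s : ℂ) ^ 2) ^ (-(1 / 2) : ℂ)) ?_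
    (hint0.add (hint.const_mul _))]
  · simp
  · intro s hs
    rw [Set.uIcc_of_le zero_le_one] at hs
    have hsl := one_sub_mul_sq_mem_slitPlane hz hs
    have h1 : HasDerivAt (fun w : ℂ => 1 - z * w ^ 2) (-(z * (2 * (s : ℂ)))) (s : ℂ) := by
      simpa using ((hasDerivAt_pow 2 (s : ℂ)).const_mul z).const_sub 1
    have h2 := ((hasDerivAt_id (s : ℂ)).mul (h1.cpow_const (c := (-(1 / 2) : ℂ)) hsl)).comp_ofReal
    refine h2.congr_deriv ?_
    rw [show (-(1 / 2) - 1 : ℂ) = -(3 / 2) by norm_num]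
    simp only [id]
    ring

theorem differentiableOn_arcsinQuot : DifferentiableOn ℂ arcsinQuot (Metric.ball 0 1) :=
  fun _ hz => (hasDerivAt_arcsinQuot (mem_ball_zero_iff.1 hz)).2.differentiableAt.differentiableWithinAt

theorem arcsinQuot_zero : arcsinQuot 0 = 1 := by simp [arcsinQuot]

theorem re_cpow_neg_half_pos {w : ℂ} (hw : w ∈ slitPlane) : 0 < (w ^ (-(1 / 2) : ℂ)).re := by
  have him : (log w * (-(1 / 2) : ℂ)).im = -(arg w / 2) := by
    rw [show (-(1 / 2) : ℂ) = ((-(1 / 2) : ℝ) : ℂ) by push_cast; rfl, im_mul_ofReal, log_im]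
    ring
  rw [cpow_def_of_ne_zero (slitPlane_ne_zero hw), exp_re, him]
  refine mul_pos (Real.exp_pos _) (Real.cos_pos_of_mem_Ioo ⟨?_, ?_⟩)
  · have := (arg_le_pi w).lt_of_ne (mem_slitPlane_iff_arg.1 hw).1
    linarith
  · have := neg_pi_lt_arg w
    linarith

theorem arcsinQuot_mem_slitPlane {z : ℂ} (hz : ‖z‖ < 1) : arcsinQuot z ∈ slitPlane := by
  refine Or.inl ?_
  have hint := intervalIntegrable_one_sub_mul_sq_cpow (-(1 / 2)) hz
  have h1 : (arcsinQuot z).re = ∫ s in (0 : ℝ)..1, ((1 - z * (s : ℂ) ^ 2) ^ (-(1 / 2) : ℂ)).re :=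
    (reCLM.intervalIntegral_comp_comm hint).symm
  rw [h1]
  refine intervalIntegral.intervalIntegral_pos_of_pos_on ?_ (fun s hs => ?_) zero_lt_one
  · exact ⟨hint.1.re, hint.2.re⟩
  · exact re_cpow_neg_half_pos (one_sub_mul_sq_mem_slitPlane hz (Set.Ioo_subset_Icc_self hs))

theorem arcsinQuot_ofReal {u : ℝ} (h0 : 0 < u) (h1 : u < 1) :
    arcsinQuot u = ((Real.arcsin (√u) / √u : ℝ) : ℂ) := by
  have hz : ‖(u : ℂ)‖ < 1 := by rwa [norm_real, Real.norm_eq_abs, abs_of_pos h0]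
  have hu : 0 < √u := Real.sqrt_pos.2 h0
  rw [arcsinQuot, intervalIntegral.integral_eq_sub_of_hasDerivAt
    (f := fun s : ℝ => ((Real.arcsin (√u * s) / √u : ℝ) : ℂ)) ?_
    (intervalIntegrable_one_sub_mul_sq_cpow _ hz)]
  · simp
  · intro s hs
    rw [Set.uIcc_of_le zero_le_one] at hs
    have hlt : √u * s < 1 := by
      have : √u < 1 := by rw [Real.sqrt_lt' one_pos]; simpa using h1
      nlinarith [hs.2, hs.1]
    have hge : 0 ≤ √u * s := mul_nonneg hu.le hs.1
    have hsq : (√u * s) ^ 2 = u * s ^ 2 := by rw [mul_pow, Real.sq_sqrt h0.le]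
    have hpos : 0 ≤ 1 - u * s ^ 2 := by rw [← hsq]; nlinarith
    have hd := (((Real.hasDerivAt_arcsin (x := √u * s) (by linarith) (by linarith)).comp s
      ((hasDerivAt_id s).const_mul (√u))).div_const (√u)).ofReal_comp
    refine hd.congr_deriv ?_
    rw [hsq, mul_one, mul_div_assoc, div_self hu.ne', mul_one, Real.sqrt_eq_rpow, one_div,
      ← Real.rpow_neg hpos, ofReal_cpow hpos]
    push_cast
    rfl

/-- The holomorphic function `(arcsin (√z) / √z) ^ (2 α)` on the unit disc. -/
noncomputable def arcsinQuotPow (α : ℝ) (z : ℂ) : ℂ :=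
  exp (2 * α * log (arcsinQuot z))

theorem hasDerivAt_arcsinQuotPow (α : ℝ) {z : ℂ} (hz : ‖z‖ < 1) :
    HasDerivAt (arcsinQuotPow α)
      (arcsinQuotPow α z * (2 * α * (deriv arcsinQuot z / arcsinQuot z))) z :=
  (((hasDerivAt_arcsinQuot hz).2.differentiableAt.hasDerivAt.clog
    (arcsinQuot_mem_slitPlane hz)).const_mul _).cexp

theorem differentiableOn_arcsinQuotPow (α : ℝ) :
    DifferentiableOn ℂ (arcsinQuotPow α) (Metric.ball 0 1) := fun _ hz =>
  (hasDerivAt_arcsinQuotPow α (mem_ball_zero_iff.1 hz)).differentiableAt.differentiableWithinAt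

theorem analyticOnNhd_arcsinQuotPow (α : ℝ) :
    AnalyticOnNhd ℂ (arcsinQuotPow α) (Metric.ball 0 1) :=
  (differentiableOn_arcsinQuotPow α).analyticOnNhd Metric.isOpen_ball

open PowerSeries in
theorem taylorPowerSeries_arcsinQuot_ode :
    (1 - X) * (taylorPowerSeries arcsinQuot +
      2 * X * d⁄dX ℂ (taylorPowerSeries arcsinQuot)) ^ 2 = 1 := by
  have hb : Metric.ball (0 : ℂ) 1 ∈ 𝓝 0 := Metric.ball_mem_nhds _ one_pos
  have hH : AnalyticAt ℂ arcsinQuot 0 := differentiableOn_arcsinQuot.analyticAt hb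
  have hid : AnalyticAt ℂ (fun z : ℂ => z) 0 := analyticAt_id
  have hc : ∀ c : ℂ, AnalyticAt ℂ (fun _ : ℂ => c) 0 := fun c => analyticAt_const
  have e1 : (1 - X : ℂ⟦X⟧) = taylorPowerSeries (fun z => 1 + (-1) * z) := by
    have h1 : AnalyticAt ℂ (fun z : ℂ => (-1) * z) 0 := (hc (-1)).mul hid
    rw [taylorPowerSeries.add (hc 1) h1, taylorPowerSeries.mul (hc (-1)) hid,
      taylorPowerSeries.const, taylorPowerSeries.const, taylorPowerSeries.id]
    simp [sub_eq_add_neg]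
  have e2 : (2 * X : ℂ⟦X⟧) = taylorPowerSeries (fun z => 2 * z) := by
    rw [taylorPowerSeries.mul (hc 2) hid, taylorPowerSeries.const, taylorPowerSeries.id, map_ofNat]
  have h2 : AnalyticAt ℂ (fun z : ℂ => 2 * z) 0 := (hc 2).mul hid
  have h3 : AnalyticAt ℂ (fun z : ℂ => arcsinQuot z + 2 * z * deriv arcsinQuot z) 0 :=
    hH.add (h2.mul hH.deriv)
  have h4 : AnalyticAt ℂ (fun z : ℂ => 2 * z * deriv arcsinQuot z) 0 := h2.mul hH.deriv
  have h5 : AnalyticAt ℂ (fun z : ℂ => 1 + (-1) * z) 0 := (hc 1).add ((hc (-1)).mul hid)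
  have h6 : AnalyticAt ℂ (fun z : ℂ => (arcsinQuot z + 2 * z * deriv arcsinQuot z) ^ 2) 0 :=
    h3.pow 2
  rw [e1, e2, ← taylorPowerSeries.derivative, ← taylorPowerSeries.mul h2 hH.deriv,
    ← taylorPowerSeries.add hH h4, ← taylorPowerSeries.pow_two h3,
    ← taylorPowerSeries.mul h5 h6, ← map_one C,
    ← taylorPowerSeries.const]
  refine taylorPowerSeries.congr ?_
  filter_upwards [hb] with z hz
  have hz' := mem_ball_zero_iff.1 hz
  have hne : 1 - z ≠ 0 := by
    rintro h
    rw [← sub_eq_zero.1 h] at hz'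
    simp at hz'
  rw [arcsinQuot_add_deriv hz', ← cpow_mul_nat]
  norm_num [cpow_neg_one]
  rw [← sub_eq_add_neg, mul_inv_cancel₀ hne]

open PowerSeries in
theorem iteratedDeriv_arcsinQuotPow_zero (α : ℝ) (n : ℕ) (hn : 1 ≤ n) :
    (Nat.factorial n : ℂ)⁻¹ * iteratedDeriv n (arcsinQuotPow α) 0 =
      (-4) ^ n * (arccosCoeff α n : ℂ) := by
  have hb : Metric.ball (0 : ℂ) 1 ∈ 𝓝 0 := Metric.ball_mem_nhds _ one_pos
  have hH : AnalyticAt ℂ arcsinQuot 0 := differentiableOn_arcsinQuot.analyticAt hb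
  have hG : AnalyticAt ℂ (arcsinQuotPow α) 0 := (differentiableOn_arcsinQuotPow α).analyticAt hb
  have hH2 : AnalyticAt ℂ (fun z => arcsinQuot z ^ 2) 0 := hH.pow 2
  have hc : AnalyticAt ℂ (fun _ : ℂ => (α : ℂ)) 0 := analyticAt_const
  have hcd : AnalyticAt ℂ (fun z => (α : ℂ) * deriv (fun z => arcsinQuot z ^ 2) z) 0 :=
    hc.mul hH2.deriv
  rw [← taylorPowerSeries.coeff]
  refine coeff_eq_arccosCoeff α (taylorPowerSeries arcsinQuot) _
    (by rw [taylorPowerSeries.constantCoeff, arcsinQuot_zero]) taylorPowerSeries_arcsinQuot_ode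
    (by simp [taylorPowerSeries.constantCoeff, arcsinQuotPow, arcsinQuot_zero]) ?_ n hn
  rw [← taylorPowerSeries.derivative, ← taylorPowerSeries.pow_two hH,
    ← taylorPowerSeries.derivative, ← taylorPowerSeries.const,
    ← taylorPowerSeries.mul hG.deriv hH2, ← taylorPowerSeries.mul hc hH2.deriv,
    ← taylorPowerSeries.mul hcd hG]
  refine taylorPowerSeries.congr ?_
  filter_upwards [hb] with z hz
  have hz' := mem_ball_zero_iff.1 hz
  have h0 := slitPlane_ne_zero (arcsinQuot_mem_slitPlane hz')
  have hd : HasDerivAt (fun z => arcsinQuot z ^ 2) _ z :=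
    (hasDerivAt_arcsinQuot hz').2.differentiableAt.hasDerivAt.pow 2
  rw [(hasDerivAt_arcsinQuotPow α hz').deriv, hd.deriv]
  field_simp
  push_cast
  ring

theorem half_one_sub_mem {x : ℝ} (hx : |x| < 1) : 0 < (1 - x) / 2 ∧ (1 - x) / 2 < 1 := by
  rw [abs_lt] at hx
  constructor <;> linarith

theorem norm_half_one_sub_lt {x : ℝ} (hx : |x| < 1) : ‖(((1 - x) / 2 : ℝ) : ℂ)‖ < 1 := by
  have := half_one_sub_mem hx
  rw [norm_real, Real.norm_eq_abs, abs_of_pos this.1]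
  exact this.2

theorem arccos_eq_two_mul_arcsin_sqrt {x : ℝ} (hx : |x| < 1) :
    Real.arccos x = 2 * Real.arcsin (√((1 - x) / 2)) := by
  obtain ⟨h0, h1⟩ := half_one_sub_mem hx
  have hs1 : √((1 - x) / 2) ≤ 1 := Real.sqrt_le_one.2 h1.le
  have hcos : Real.cos (2 * Real.arcsin (√((1 - x) / 2))) = x := by
    rw [Real.cos_two_mul', Real.cos_sq', Real.sin_arcsin (by linarith [Real.sqrt_nonneg ((1 - x) / 2)]) hs1,
      Real.sq_sqrt h0.le]
    ring
  conv_lhs => rw [← hcos]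
  refine Real.arccos_cos ?_ ?_
  · have := Real.arcsin_nonneg.2 (Real.sqrt_nonneg ((1 - x) / 2)); linarith
  · have := Real.arcsin_le_pi_div_two (√((1 - x) / 2)); linarith

theorem arcsinQuotPow_half_one_sub (α : ℝ) {x : ℝ} (hx : |x| < 1) :
    arcsinQuotPow α (((1 - x) / 2 : ℝ) : ℂ) =
      (((Real.arccos x ^ 2 / (2 * (1 - x))) ^ α : ℝ) : ℂ) := by
  obtain ⟨h0, h1⟩ := half_one_sub_mem hx
  set u := (1 - x) / 2 with hu
  have hs : 0 < √u := Real.sqrt_pos.2 h0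
  have hr : 0 < Real.arcsin (√u) / √u := div_pos (Real.arcsin_pos.2 hs) hs
  have hF : Real.arccos x ^ 2 / (2 * (1 - x)) = (Real.arcsin (√u) / √u) ^ 2 := by
    rw [arccos_eq_two_mul_arcsin_sqrt hx, ← hu, div_pow, Real.sq_sqrt h0.le,
      show 2 * (1 - x) = 4 * u by rw [hu]; ring]
    field_simp
    ring
  rw [arcsinQuotPow, arcsinQuot_ofReal h0 h1, ← ofReal_log hr.le, hF,
    Real.rpow_def_of_pos (pow_pos hr 2), Real.log_pow]
  push_cast
  ring_nf

theorem hasSum_arccosCoeff (α : ℝ) {x : ℝ} (hx : |x| < 1) :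
    HasSum (fun n : ℕ => arccosCoeff α (n + 1) * (2 * (x - 1)) ^ (n + 1))
      ((Real.arccos x ^ 2 / (2 * (1 - x))) ^ α - 1) := by
  have hs := hasSum_taylorSeries_on_ball (differentiableOn_arcsinQuotPow α)
    (mem_ball_zero_iff.2 (norm_half_one_sub_lt hx))
  rw [arcsinQuotPow_half_one_sub α hx, ← hasSum_nat_add_iff' 1] at hs
  rw [← hasSum_ofReal]
  have hf : (fun n : ℕ => ((arccosCoeff α (n + 1) * (2 * (x - 1)) ^ (n + 1) : ℝ) : ℂ)) =
      fun n : ℕ => (Nat.factorial (n + 1) : ℂ)⁻¹ • ((((1 - x) / 2 : ℝ) : ℂ) - 0) ^ (n + 1) •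
        iteratedDeriv (n + 1) (arcsinQuotPow α) 0 := by
    ext n
    have := iteratedDeriv_arcsinQuotPow_zero α (n + 1) (by omega)
    rw [smul_eq_mul, smul_eq_mul, mul_left_comm, this, sub_zero]
    push_cast
    rw [show (2 * ((x : ℂ) - 1)) = (-4) * ((1 - x) / 2) by ring, mul_pow]
    ring
  rw [hf]
  simpa [arcsinQuotPow, arcsinQuot_zero] using hs

theorem iteratedDeriv_arccos_rpow (α : ℝ) (n : ℕ) {x : ℝ} (hx : |x| < 1) :
    iteratedDeriv n (fun x : ℝ => (Real.arccos x ^ 2 / (2 * (1 - x))) ^ α) x =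
      ((-(1 / 2)) ^ n * iteratedDeriv n (arcsinQuotPow α) (((1 - x) / 2 : ℝ) : ℂ)).re := by
  induction n generalizing x with
  | zero => simp only [iteratedDeriv_zero, pow_zero, one_mul, arcsinQuotPow_half_one_sub α hx,
      ofReal_re]
  | succ n ih =>
    have hev : iteratedDeriv n (fun x : ℝ => (Real.arccos x ^ 2 / (2 * (1 - x))) ^ α) =ᶠ[𝓝 x]
        fun x => ((-(1 / 2)) ^ n *
          iteratedDeriv n (arcsinQuotPow α) (((1 - x) / 2 : ℝ) : ℂ)).re := by
      filter_upwards [(isOpen_lt continuous_abs continuous_const).mem_nhds hx] with y hy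
      exact ih hy
    rw [iteratedDeriv_succ, hev.deriv_eq]
    have hd : HasDerivAt (iteratedDeriv n (arcsinQuotPow α))
        (iteratedDeriv (n + 1) (arcsinQuotPow α) (((1 - x) / 2 : ℝ) : ℂ))
        (((1 - x) / 2 : ℝ) : ℂ) := by
      rw [iteratedDeriv_succ]
      have := (analyticOnNhd_arcsinQuotPow α).iterated_deriv n
      rw [← iteratedDeriv_eq_iterate] at this
      exact (this _ (mem_ball_zero_iff.2 (norm_half_one_sub_lt hx))).differentiableAt.hasDerivAt
    have hi : HasDerivAt (fun w : ℂ => (1 - w) / 2) (-1 / 2) (x : ℂ) :=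
      ((hasDerivAt_id _).const_sub 1).div_const 2
    have e : (((1 - x) / 2 : ℝ) : ℂ) = (1 - (x : ℂ)) / 2 := by push_cast; rfl
    rw [e] at hd ⊢
    have := ((hd.comp (x : ℂ) hi).const_mul ((-(1 / 2)) ^ n)).real_of_complex
    rw [show ((-(1 / 2)) ^ (n + 1) * iteratedDeriv (n + 1) (arcsinQuotPow α) ((1 - (x : ℂ)) / 2)) =
      (-(1 / 2)) ^ n * (iteratedDeriv (n + 1) (arcsinQuotPow α) ((1 - (x : ℂ)) / 2) * (-1 / 2)) by
        ring, ← this.deriv]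
    push_cast
    rfl

theorem tendsto_iteratedDeriv_arccos_rpow (α : ℝ) (n : ℕ) (hn : 1 ≤ n) :
    Tendsto (iteratedDeriv n fun x : ℝ => (Real.arccos x ^ 2 / (2 * (1 - x))) ^ α) (𝓝[<] 1)
      (𝓝 ((Nat.factorial n : ℝ) * (2 ^ n * arccosCoeff α n))) := by
  have hlim : Tendsto (fun x : ℝ => ((-(1 / 2)) ^ n *
      iteratedDeriv n (arcsinQuotPow α) (((1 - x) / 2 : ℝ) : ℂ)).re) (𝓝 1)
      (𝓝 ((Nat.factorial n : ℝ) * (2 ^ n * arccosCoeff α n))) := by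
    have hc : ContinuousAt (iteratedDeriv n (arcsinQuotPow α)) (((1 - (1 : ℝ)) / 2 : ℝ) : ℂ) := by
      have := (analyticOnNhd_arcsinQuotPow α).iterated_deriv n
      rw [← iteratedDeriv_eq_iterate] at this
      exact (this _ (by simp)).continuousAt
    have hu : ContinuousAt (fun x : ℝ => (((1 - x) / 2 : ℝ) : ℂ)) 1 := by fun_prop
    have h1 := (continuous_re.continuousAt.comp
      ((ContinuousAt.comp (x := (1 : ℝ)) hc hu).const_mul ((-(1 / 2) : ℂ) ^ n))).tendsto
    have hz : (Nat.factorial n : ℂ) ≠ 0 := Nat.cast_ne_zero.2 (Nat.factorial_ne_zero n)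
    have hcoef := iteratedDeriv_arcsinQuotPow_zero α n hn
    rw [inv_mul_eq_iff_eq_mul₀ hz] at hcoef
    have h4 : (-(1 / 2) : ℂ) ^ n * (-4) ^ n = 2 ^ n := by rw [← mul_pow]; norm_num
    have : (-(1 / 2) : ℂ) ^ n * iteratedDeriv n (arcsinQuotPow α) 0 =
        (((Nat.factorial n : ℝ) * (2 ^ n * arccosCoeff α n) : ℝ) : ℂ) := by
      rw [hcoef]
      push_cast
      rw [← h4]
      ring
    have hval : (Nat.factorial n : ℝ) * (2 ^ n * arccosCoeff α n) = ((-(1 / 2)) ^ n *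
        iteratedDeriv n (arcsinQuotPow α) (((1 - (1 : ℝ)) / 2 : ℝ) : ℂ)).re := by
      rw [sub_self, zero_div, ofReal_zero, this, ofReal_re]
    rw [hval]
    exact h1
  refine (hlim.mono_left nhdsWithin_le_nhds).congr' ?_
  filter_upwards [Ioo_mem_nhdsLT (show (-1 : ℝ) < 1 by norm_num)] with x hx
  exact (iteratedDeriv_arccos_rpow α n (abs_lt.2 hx)).symm

end

theorem theorem5p2 (α : ℝ) :
    (∀ x : ℝ, |x| < 1 →
      Summable (fun n : ℕ => arccosCoeff α (n + 1) * (2 * (x - 1)) ^ (n + 1)) ∧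
      (Real.arccos x ^ 2 / (2 * (1 - x))) ^ α =
        1 + ∑' n : ℕ, arccosCoeff α (n + 1) * (2 * (x - 1)) ^ (n + 1)) ∧
    (∀ n : ℕ, 1 ≤ n →
      Tendsto (iteratedDeriv n fun x : ℝ => (Real.arccos x ^ 2 / (2 * (1 - x))) ^ α) (𝓝[<] 1)
        (𝓝 ((Nat.factorial n : ℝ) * (2 ^ n * arccosCoeff α n)))) := by
  refine ⟨fun x hx => ?_, tendsto_iteratedDeriv_arccos_rpow α⟩
  have h := hasSum_arccosCoeff α hx
  exact ⟨h.summable, by rw [h.tsum_eq]; ring⟩
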